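/- For an integral simplex $\mathcal P\subset\mathbb R^d$ of dimension $d$ (the convex hull of $d+1$ affinely independent points of $\mathbb Z^d$), the $\delta$-vector $\delta(\mathcal P)=(\delta_0,\dots,\delta_d)$ is given by the coefficients of $\lambda^0,\dots,\lambda^d$ in $(1-\lambda)^{d+1}\sum_{n\ge 0}|n\mathcal P\cap\mathbb Z^d|\,\lambda^n$. For nonnegative integers $d_1,\dots,d_6$ with $d_1+\cdots+d_6\le d-1$, let $\mathcal P_7(d_1,\dots,d_6)\subset\mathbb R^d$ be the convex hull of the origin, the first $d-1$ standard unit vectors, and the vector whose first $d-1$ coordinates are $d_1$ copies of $1$, then $d_2$ copies of $2$, …, then $d_6$ copies of $6$, then zeros, and whose last coordinate is $7$. **Theorem 0.3.** Let $(\delta_0,\delta_1,\dots,\delta_d)$ be a sequence of nonnegative integers with $\delta_0=1$ and $\sum_{i=0}^d\delta_i=7$, and let $1\le i_1\le\cdots\le i_6\le d$ be the integers with $\sum_{i=0}^d\delta_i t^i=1+t^{i_1}+\cdots+t^{i_6}$. There exists an integral simplex $\mathcal P\subset\mathbb R^d$ of dimension $d$ with $\delta(\mathcal P)=(\delta_0,\dots,\delta_d)$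 if and only if $$i_1+i_6=i_2+i_5=i_3+i_4\le d+1\quad\text{and}\quad i_k+i_\ell\ge i_{k+\ell}\ \text{ for all } 1\le k\le\ell \text{ with } k+\ell\le 6.$$ Moreover, if these conditions hold, then one of the following eight (mutually exclusive) cases occurs. In that case the listed parameters are nonnegative integers with sum at most $d-1$, and the listed $\mathcal P_7(d_1,\dots,d_6)$ is an integral simplex of dimension $d$ with $\delta$-vector $(\delta_0,\dots,\delta_d)$: 1. $i_1=\cdots=i_6$: $\mathcal P_7(0,0,i_1-1,i_1-1,0,0)$; 2. $i_1=i_2=i_3<i_4=i_5=i_6$: $\mathcal P_7(0,i_4-i_1,2i_1-i_4,2i_1-i_4,0,2i_4-2i_1-2)$; 3. $i_1<i_2=i_3=i_4=i_5<i_6$: $\mathcal P_7(i_1+i_2-i_6,i_6-i_2,i_6-i_1-1,0,0,i_1-1)$; 4. $i_1=i_2<i_3=i_4<i_5=i_6$: $\mathcal P_7(0,0,i_1-1,i_1+i_3-i_5,0,3i_5-3i_3-1)$; 5. $i_1<i_2=i_3<i_4=i_5<i_6$: $\mathcal P_7(0,2i_1-i_2,0,i_2-i_1,i_1+i_2-i_4,2i_4-2i_1-2)$;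 6. $i_1=i_2<i_3<i_4<i_5=i_6$: $\mathcal P_7(0,i_4-i_3-1,i_1+i_3-i_4,2i_1-i_4,0,i_3+2i_4-3i_1-1)$; 7. $i_1<i_2<i_3=i_4<i_5<i_6$: $\mathcal P_7(0,0,2i_1-i_2,i_1+i_2-i_3,i_2-i_1,3i_3-2i_1-i_2-2)$; 8. $i_1<i_2<i_3<i_4<i_5<i_6$: $\mathcal P_7(0,i_1+i_2-i_3,i_1+i_3-2i_2,0,2i_2-i_4,i_3+2i_4-2i_1-i_2-2)$ if $i_1+i_3\ge 2i_2$, and $\mathcal P_7(0,2i_1-i_2,0,2i_2-i_1-i_3,i_1+i_3-i_4,i_3+2i_4-2i_1-i_2-2)$ if $i_1+i_3\le 2i_2$. -/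

import Mathlib

/-- The number of points of `ℤ^N` that lie in `S ⊆ ℝ^N`. -/
noncomputable def latticePointCount {N : ℕ} (S : Set (Fin N → ℝ)) : ℕ :=
  Set.ncard {x : Fin N → ℝ | x ∈ S ∧ ∀ j, ∃ z : ℤ, x j = (z : ℝ)}

/-- The enumerative function `i(P, n) = |nP ∩ ℤ^N|`, where `nP = {n α : α ∈ P}`. For nonempty `P`
one has `0 P = {0}`, so that `i(P, 0) = 1`. -/
noncomputable def ehrhartCount {N : ℕ} (P : Set (Fin N → ℝ)) (n : ℕ) : ℕ :=
  latticePointCount ((fun x : Fin N → ℝ => (n : ℝ) • x) '' P)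

/-- The δ-vector `(δ_0, …, δ_d)` of an integral convex polytope `P` of dimension `d`: `δ_j` is the
coefficient of `λ^j` in the power series `(1 - λ)^(d+1) ∑_{n ≥ 0} i(P, n) λ^n`. -/
noncomputable def deltaVector {N : ℕ} (d : ℕ) (P : Set (Fin N → ℝ)) : Fin (d + 1) → ℤ :=
  fun j => PowerSeries.coeff (j : ℕ)
    ((1 - PowerSeries.X) ^ (d + 1) *
      PowerSeries.mk (fun n => (ehrhartCount P n : ℤ)) : PowerSeries ℤ)

/-- A `d`-simplex in `ℝ^N` is integral if all its vertices have integer coordinates. -/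
def IsIntegralSimplex {N d : ℕ} (s : Affine.Simplex ℝ (Fin N → ℝ) d) : Prop :=
  ∀ k j, ∃ z : ℤ, s.points k j = (z : ℝ)

/-- The simplex, as a point set, is the convex hull of its vertices. -/
def simplexBody {N d : ℕ} (s : Affine.Simplex ℝ (Fin N → ℝ) d) : Set (Fin N → ℝ) :=
  convexHull ℝ (Set.range s.points)

/-- The list `1, …, 1, 2, …, 2, …, 6, …, 6` in which `j` occurs `d_j` times; here `c` is the tuple
`(d_1, …, d_6)`, indexed from `0`. -/
def lastRowEntries (c : Fin 6 → ℕ) : List ℕ :=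
  (List.finRange 6).flatMap fun j => List.replicate (c j) ((j : ℕ) + 1)

/-- The `d × d` matrix `A_7(d_1, …, d_6)`. Its first `d - 1` rows are those of the identity matrix.
Its last row consists of `d - 1` entries among which `d_j` are equal to `j`, for `j = 1, …, 6`, and
the others are `0` (which presupposes `d_1 + ⋯ + d_6 ≤ d - 1`), followed by the entry `7`. -/
def matrixA7 (d : ℕ) (c : Fin 6 → ℕ) : Matrix (Fin d) (Fin d) ℤ :=
  fun r k =>
    if (r : ℕ) + 1 = d then
      if k = r then 7 else (((lastRowEntries c).getD (k : ℕ) 0 : ℕ) : ℤ)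
    else
      if k = r then 1 else 0

/-- The vertices of `P_7(d_1, …, d_6)`: the origin and the rows of `A_7(d_1, …, d_6)`. -/
def verticesP7 (d : ℕ) (c : Fin 6 → ℕ) : Fin (d + 1) → Fin d → ℝ :=
  Fin.cons 0 (fun r k => (matrixA7 d c r k : ℝ))

/-- `P_7(c_1, …, c_6) ⊆ ℝ^d` is defined (the integers `c_j` are nonnegative and their sum is at most
`d - 1`), it is an integral simplex of dimension `d`, and its δ-vector is `δ`. -/
def RealizedByP7 {d : ℕ} (δ : Fin (d + 1) → ℕ) (c : Fin 6 → ℤ) : Prop :=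
  (∀ j, 0 ≤ c j) ∧ ∑ j, c j ≤ (d : ℤ) - 1 ∧
    ∃ s : Affine.Simplex ℝ (Fin d → ℝ) d,
      s.points = verticesP7 d (fun j => (c j).toNat) ∧ IsIntegralSimplex s ∧
        ∀ j, deltaVector d (simplexBody s) j = (δ j : ℤ)

/-- `i_1 ≤ ⋯ ≤ i_6` are the exponents of `δ = (δ_0, …, δ_d)`: integers with
`1 ≤ i_1 ≤ ⋯ ≤ i_6 ≤ d` and `∑ δ_j t^j = 1 + t^{i_1} + ⋯ + t^{i_6}`. Only the values of `i` at
`1, …, 6` matter. -/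
def IsExponentSequence {d : ℕ} (δ : Fin (d + 1) → ℕ) (i : ℕ → ℕ) : Prop :=
  (∀ k ∈ Finset.Icc 1 6, 1 ≤ i k ∧ i k ≤ d) ∧
  i 1 ≤ i 2 ∧ i 2 ≤ i 3 ∧ i 3 ≤ i 4 ∧ i 4 ≤ i 5 ∧ i 5 ≤ i 6 ∧
  (∑ j : Fin (d + 1), Polynomial.C (δ j : ℤ) * Polynomial.X ^ (j : ℕ) : Polynomial ℤ) =
    1 + ∑ k ∈ Finset.Icc 1 6, Polynomial.X ^ i k

/-- `i_1 + i_6 = i_2 + i_5 = i_3 + i_4 ≤ d + 1`, and `i_k + i_l ≥ i_{k+l}` for `1 ≤ k ≤ l` with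
`k + l ≤ 6`. -/
def ExponentConditions (d : ℕ) (i : ℕ → ℕ) : Prop :=
  (i 1 + i 6 = i 2 + i 5 ∧ i 2 + i 5 = i 3 + i 4 ∧ i 3 + i 4 ≤ d + 1) ∧
  ∀ k l : ℕ, 1 ≤ k → k ≤ l → k + l ≤ 6 → i (k + l) ≤ i k + i l

/-- One of eight (mutually exclusive) cases occurs, according to which of the exponents
`x_1 ≤ ⋯ ≤ x_6` coincide, and the simplex given explicitly for that case has δ-vector `δ`. -/
def ExplicitRealizations {d : ℕ} (δ : Fin (d + 1) → ℕ) (x₁ x₂ x₃ x₄ x₅ x₆ : ℤ) : Prop :=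
  (x₁ = x₂ ∧ x₂ = x₃ ∧ x₃ = x₄ ∧ x₄ = x₅ ∧ x₅ = x₆ ∧
    RealizedByP7 δ ![0, 0, x₁ - 1, x₁ - 1, 0, 0]) ∨
  (x₁ = x₂ ∧ x₂ = x₃ ∧ x₃ < x₄ ∧ x₄ = x₅ ∧ x₅ = x₆ ∧
    RealizedByP7 δ ![0, x₄ - x₁, 2 * x₁ - x₄, 2 * x₁ - x₄, 0, 2 * x₄ - 2 * x₁ - 2]) ∨
  (x₁ < x₂ ∧ x₂ = x₃ ∧ x₃ = x₄ ∧ x₄ = x₅ ∧ x₅ < x₆ ∧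
    RealizedByP7 δ ![x₁ + x₂ - x₆, x₆ - x₂, x₆ - x₁ - 1, 0, 0, x₁ - 1]) ∨
  (x₁ = x₂ ∧ x₂ < x₃ ∧ x₃ = x₄ ∧ x₄ < x₅ ∧ x₅ = x₆ ∧
    RealizedByP7 δ ![0, 0, x₁ - 1, x₁ + x₃ - x₅, 0, 3 * x₅ - 3 * x₃ - 1]) ∨
  (x₁ < x₂ ∧ x₂ = x₃ ∧ x₃ < x₄ ∧ x₄ = x₅ ∧ x₅ < x₆ ∧
    RealizedByP7 δ
      ![0, 2 * x₁ - x₂, 0, x₂ - x₁, x₁ + x₂ - x₄, 2 * x₄ - 2 * x₁ - 2]) ∨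
  (x₁ = x₂ ∧ x₂ < x₃ ∧ x₃ < x₄ ∧ x₄ < x₅ ∧ x₅ = x₆ ∧
    RealizedByP7 δ
      ![0, x₄ - x₃ - 1, x₁ + x₃ - x₄, 2 * x₁ - x₄, 0, x₃ + 2 * x₄ - 3 * x₁ - 1]) ∨
  (x₁ < x₂ ∧ x₂ < x₃ ∧ x₃ = x₄ ∧ x₄ < x₅ ∧ x₅ < x₆ ∧
    RealizedByP7 δ
      ![0, 0, 2 * x₁ - x₂, x₁ + x₂ - x₃, x₂ - x₁, 3 * x₃ - 2 * x₁ - x₂ - 2]) ∨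
  (x₁ < x₂ ∧ x₂ < x₃ ∧ x₃ < x₄ ∧ x₄ < x₅ ∧ x₅ < x₆ ∧
    (2 * x₂ ≤ x₁ + x₃ →
      RealizedByP7 δ
        ![0, x₁ + x₂ - x₃, x₁ + x₃ - 2 * x₂, 0, 2 * x₂ - x₄,
          x₃ + 2 * x₄ - 2 * x₁ - x₂ - 2]) ∧
    (x₁ + x₃ ≤ 2 * x₂ →
      RealizedByP7 δ
        ![0, 2 * x₁ - x₂, 0, 2 * x₂ - x₁ - x₃, x₁ + x₃ - x₄,
          x₃ + 2 * x₄ - 2 * x₁ - x₂ - 2]))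

/-!
For an integral simplex with vertices `v_0, …, v_d`, consider the weights `α ∈ ℝ^{d+1}` for which
both `∑ α_k v_k` and `∑ α_k` are integral. The nonnegative ones of total `n` are the scaled
barycentric coordinates of the lattice points of the `n`-th dilate. Splitting each `α_k` into its
integer and fractional parts shows that the Ehrhart series is `∑_g λ^{ht g} / (1 - λ)^{d+1}`, where
`g` runs over the finite box of such weights with entries in `[0, 1)` and `ht g = ∑ g_k`. Hence
`δ_j` is the number of box elements of height `j` (`deltaVector_simplexBody`). The box represents
the quotient of the lattice of weights by `ℤ^{d+1}`, so it is a group under addition modulo `1`.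

If `∑ δ_j = 7`, this group is cyclic of order `7`, and its elements are `((m a_k) mod 7) / 7` for
`m ∈ ℤ/7ℤ` and a fixed residue vector `a` (`exists_weightBox_eq_range_residueWeights`). The height,
as a function of `m`, is subadditive, and the heights of `m` and `-m` have the constant sum
`|{k : a_k ≠ 0}| ≤ d + 1` for `m ≠ 0`. The exponents `i_1 ≤ ⋯ ≤ i_6` are the sorted heights of
the nonzero `m`. Opposite positions therefore have constant sum (`sorted_add_sorted_sub`), and
`i_{k+l} ≤ i_k + i_l` follows from the Cauchy-Davenport theorem (`sorted_add_le`): adding an argument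
among the `k + 1` of least height to one among the `l + 1` of least height produces at least
`k + l + 1` arguments, all of height at most `i_k + i_l`.

Conversely, the box of `P_7(d_1, …, d_6)` is generated by an explicit residue vector
(`weightBox_verticesP7`), and the height of its `m`-th multiple is
`⌈(m + ∑_j d_j ((-m j) mod 7)) / 7⌉`. With the parameters of each of the eight cases these six
numbers are `i_1, …, i_6`, up to order, which is a matter of linear arithmetic
(`explicitRealizations_of_exponentConditions`).
-/

/-! ### The δ-vector of an integral simplex -/

/-- The real weights `α` on a family of points `v` of `ℝ^N` for which `(∑ α_k v_k, ∑ α_k)` is an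
integer vector of `ℝ^N × ℝ`. -/
def weightLattice {ι : Type*} [Fintype ι] {N : ℕ} (v : ι → Fin N → ℝ) :
    AddSubgroup (ι → ℝ) where
  carrier := {α | (∃ z : ℤ, ∑ k, α k = z) ∧ ∀ j, ∃ z : ℤ, ∑ k, α k * v k j = z}
  add_mem' := by
    rintro α β ⟨⟨a, ha⟩, hα⟩ ⟨⟨b, hb⟩, hβ⟩
    refine ⟨⟨a + b, by simp [Finset.sum_add_distrib, ha, hb]⟩, fun j => ?_⟩
    obtain ⟨a, ha⟩ := hα j
    obtain ⟨b, hb⟩ := hβ j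
    exact ⟨a + b, by simp [add_mul, Finset.sum_add_distrib, ha, hb]⟩
  zero_mem' := ⟨⟨0, by simp⟩, fun j => ⟨0, by simp⟩⟩
  neg_mem' := by
    rintro α ⟨⟨a, ha⟩, hα⟩
    refine ⟨⟨-a, by simp [ha]⟩, fun j => ?_⟩
    obtain ⟨a, ha⟩ := hα j
    exact ⟨-a, by simp [ha]⟩

/-- The weights in `weightLattice v` all of whose entries lie in `[0, 1)`. If the points `v k` are
integral, they represent the quotient of `weightLattice v` by the integer weights. -/
def weightBox {ι : Type*} [Fintype ι] {N : ℕ} (v : ι → Fin N → ℝ) : Set (ι → ℝ) :=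
  {α | α ∈ weightLattice v ∧ ∀ k, 0 ≤ α k ∧ α k < 1}

/-- The nonnegative weights in `weightLattice v` of total weight `n`. -/
def weightSlice {ι : Type*} [Fintype ι] {N : ℕ} (v : ι → Fin N → ℝ) (n : ℕ) : Set (ι → ℝ) :=
  {α | α ∈ weightLattice v ∧ (∀ k, 0 ≤ α k) ∧ ∑ k, α k = n}

theorem intCast_mem_weightLattice {ι : Type*} [Fintype ι] {N : ℕ} {v : ι → Fin N → ℝ}
    (hv : ∀ k j, ∃ z : ℤ, v k j = z) (a : ι → ℤ) : (fun k => (a k : ℝ)) ∈ weightLattice v := by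
  choose w hw using hv
  exact ⟨⟨∑ k, a k, by simp⟩, fun j => ⟨∑ k, a k * w k j, by simp [hw]⟩⟩

theorem fract_mem_weightBox {ι : Type*} [Fintype ι] {N : ℕ} {v : ι → Fin N → ℝ}
    (hv : ∀ k j, ∃ z : ℤ, v k j = z) {α : ι → ℝ} (hα : α ∈ weightLattice v) :
    (fun k => Int.fract (α k)) ∈ weightBox v :=
  ⟨(weightLattice v).sub_mem hα (intCast_mem_weightLattice hv fun k => ⌊α k⌋),
    fun _ => ⟨Int.fract_nonneg _, Int.fract_lt_one _⟩⟩

theorem AffineIndependent.eq_of_weightedSum_eq {ι : Type*} [Fintype ι] {N : ℕ}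
    {v : ι → Fin N → ℝ} (h : AffineIndependent ℝ v) {α β : ι → ℝ} (h0 : ∑ k, α k = ∑ k, β k)
    (h1 : ∀ j, ∑ k, α k * v k j = ∑ k, β k * v k j) : α = β := by
  rw [affineIndependent_iff] at h
  funext k
  have := h Finset.univ (α - β) (by simp [h0]) (by ext; simp [sub_mul, h1]) k (Finset.mem_univ _)
  simpa [sub_eq_zero] using this

theorem weightBox_finite {ι : Type*} [Fintype ι] {N : ℕ} {v : ι → Fin N → ℝ}
    (h : AffineIndependent ℝ v) : (weightBox v).Finite := by
  -- A weight in the box is determined by its weighted sum and its total, which are integral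
  -- and bounded.
  let F : (ι → ℝ) → (Fin N → ℤ) × ℤ := fun α => (fun j => ⌊∑ k, α k * v k j⌋, ⌊∑ k, α k⌋)
  let b : Fin N → ℤ := fun j => ⌈∑ k, |v k j|⌉
  have hfin : (Set.Icc (-b - 1) b ×ˢ Set.Icc (0 : ℤ) (Fintype.card ι) :
      Set ((Fin N → ℤ) × ℤ)).Finite := (Set.finite_Icc _ _).prod (Set.finite_Icc _ _)
  refine Set.Finite.of_finite_image (f := F) (hfin.subset ?_) ?_
  · rintro _ ⟨α, ⟨-, hα⟩, rfl⟩
    have habs : ∀ j, |∑ k, α k * v k j| ≤ b j := fun j => by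
      refine (Finset.abs_sum_le_sum_abs _ _).trans (le_trans ?_ (Int.le_ceil _))
      refine Finset.sum_le_sum fun k _ => ?_
      rw [abs_mul, abs_of_nonneg (hα k).1]
      exact mul_le_of_le_one_left (abs_nonneg _) (hα k).2.le
    refine ⟨⟨fun j => ?_, fun j => ?_⟩, ?_, ?_⟩
    · rw [Int.le_floor]
      have := neg_le_of_abs_le (habs j)
      push_cast [Pi.sub_apply, Pi.neg_apply, Pi.one_apply]
      linarith
    · have := (Int.floor_le _).trans (le_of_abs_le (habs j))
      exact_mod_cast this
    · exact Int.floor_nonneg.2 (Finset.sum_nonneg fun k _ => (hα k).1)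
    · have : ∑ k, α k ≤ Fintype.card ι := by
        simpa using Finset.sum_le_sum fun k (_ : k ∈ Finset.univ) ↦ (hα k).2.le
      have := (Int.floor_le _).trans this
      exact_mod_cast this
  · rintro α ⟨⟨⟨a, ha⟩, hα⟩, -⟩ β ⟨⟨⟨c, hc⟩, hβ⟩, -⟩ hF
    simp only [F, Prod.mk.injEq, funext_iff] at hF
    refine h.eq_of_weightedSum_eq ?_ fun j => ?_
    · have := hF.2
      rw [ha, hc, Int.floor_intCast, Int.floor_intCast] at this
      rw [ha, hc, this]
    · have := hF.1 j
      obtain ⟨x, hx⟩ := hα j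
      obtain ⟨y, hy⟩ := hβ j
      rw [hx, hy, Int.floor_intCast, Int.floor_intCast] at this
      rw [hx, hy, this]

theorem mem_convexHull_range_iff_exists_weights {ι : Type*} [Fintype ι] {N : ℕ}
    {v : ι → Fin N → ℝ} {x : Fin N → ℝ} :
    x ∈ convexHull ℝ (Set.range v) ↔
      ∃ w : ι → ℝ, (∀ k, 0 ≤ w k) ∧ ∑ k, w k = 1 ∧ ∀ j, x j = ∑ k, w k * v k j := by
  classical
  let L : (ι → ℝ) →ₗ[ℝ] (Fin N → ℝ) := ∑ k, (LinearMap.proj (R := ℝ) k).smulRight (v k)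
  have hL : ∀ w j, L w j = ∑ k, w k * v k j := fun w j => by simp [L]
  have : Set.range v = L '' Set.range (fun i : ι => (Pi.single i 1 : ι → ℝ)) := by
    rw [← Set.range_comp]
    congr 1
    funext i j
    simp [hL, Pi.single_apply]
  rw [this, ← LinearMap.image_convexHull, convexHull_rangle_single_eq_stdSimplex]
  constructor
  · rintro ⟨w, ⟨h0, h1⟩, rfl⟩
    exact ⟨w, h0, h1, hL w⟩
  · rintro ⟨w, h0, h1, h⟩
    exact ⟨w, ⟨h0, h1⟩, funext fun j => by rw [hL, h]⟩

/-- Barycentric coordinates, scaled by `n`, identify the lattice points of the `n`-th dilate of a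
simplex with the nonnegative lattice weights of total weight `n`. -/
theorem ehrhartCount_convexHull_range {ι : Type*} [Fintype ι] [Nonempty ι] {N : ℕ}
    {v : ι → Fin N → ℝ} (h : AffineIndependent ℝ v) (n : ℕ) :
    ehrhartCount (convexHull ℝ (Set.range v)) n = (weightSlice v n).ncard := by
  classical
  have key : {x : Fin N → ℝ | x ∈ (fun x : Fin N → ℝ => (n : ℝ) • x) '' convexHull ℝ (Set.range v) ∧
      ∀ j, ∃ z : ℤ, x j = (z : ℝ)} = (fun α j => ∑ k, α k * v k j) '' weightSlice v n := by
    ext x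
    constructor
    · rintro ⟨⟨y, hy, rfl⟩, hx⟩
      obtain ⟨w, h0, h1, hw⟩ := mem_convexHull_range_iff_exists_weights.1 hy
      have hs : ∀ j, ∑ k, (n : ℝ) * w k * v k j = n * y j := fun j => by
        rw [hw, Finset.mul_sum]
        exact Finset.sum_congr rfl fun k _ => mul_assoc _ _ _
      have ht : ∑ k, (n : ℝ) * w k = n := by rw [← Finset.mul_sum, h1, mul_one]
      refine ⟨fun k => n * w k, ⟨⟨⟨n, by simpa using ht⟩, fun j => ?_⟩,
        fun k => mul_nonneg n.cast_nonneg (h0 k), ht⟩, funext fun j => ?_⟩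
      · obtain ⟨z, hz⟩ := hx j
        exact ⟨z, by rw [hs, ← hz]; rfl⟩
      · simpa using hs j
    · rintro ⟨α, ⟨⟨-, hα⟩, h0, h1⟩, rfl⟩
      refine ⟨?_, hα⟩
      rcases Nat.eq_zero_or_pos n with rfl | hn
      · have hz : α = 0 := by
          rw [Nat.cast_zero, Finset.sum_eq_zero_iff_of_nonneg fun k _ => h0 k] at h1
          exact funext fun k => h1 k (Finset.mem_univ k)
        exact ⟨v (Classical.arbitrary ι), subset_convexHull ℝ _ ⟨_, rfl⟩, by ext; simp [hz]⟩
      · have hn' : (n : ℝ) ≠ 0 := by positivity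
        refine ⟨fun j => ∑ k, α k / n * v k j, mem_convexHull_range_iff_exists_weights.2
          ⟨fun k => α k / n, fun k => div_nonneg (h0 k) n.cast_nonneg, ?_, fun j => rfl⟩, ?_⟩
        · rw [← Finset.sum_div, h1, div_self hn']
        · funext j
          simp only [Pi.smul_apply, smul_eq_mul, Finset.mul_sum]
          exact Finset.sum_congr rfl fun k _ => by field_simp
  rw [ehrhartCount, latticePointCount, key, Set.InjOn.ncard_image]
  rintro α ⟨-, -, hα⟩ β ⟨-, -, hβ⟩ hab
  exact h.eq_of_weightedSum_eq (by rw [hα, hβ]) fun j => congrFun hab j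

theorem natCast_floor_sum_of_mem_weightBox {ι : Type*} [Fintype ι] {N : ℕ}
    {v : ι → Fin N → ℝ} {α : ι → ℝ} (hα : α ∈ weightBox v) :
    ((⌊∑ k, α k⌋₊ : ℕ) : ℝ) = ∑ k, α k := by
  obtain ⟨⟨⟨z, hz⟩, -⟩, hb⟩ := hα
  have h0 : 0 ≤ ∑ k, α k := Finset.sum_nonneg fun k _ => (hb k).1
  rw [hz] at h0 ⊢
  lift z to ℕ using by exact_mod_cast h0
  simp

/-- Splitting weights into integer and fractional parts counts the lattice weights of total
weight `n` by their fractional part. -/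
theorem ncard_weightSlice {ι : Type*} [Fintype ι] [DecidableEq ι] {N : ℕ} {v : ι → Fin N → ℝ}
    (hv : ∀ k j, ∃ z : ℤ, v k j = z) (B : Finset (ι → ℝ)) (hB : (B : Set (ι → ℝ)) = weightBox v)
    (n : ℕ) : (weightSlice v n).ncard =
      ∑ g ∈ B, if ⌊∑ k, g k⌋₊ ≤ n then
        (Finset.piAntidiag (Finset.univ : Finset ι) (n - ⌊∑ k, g k⌋₊)).card else 0 := by
  classical
  have hBm : ∀ g, g ∈ B ↔ g ∈ weightBox v := fun g => by rw [← hB, Finset.mem_coe]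
  let S := B.sigma fun g => if ⌊∑ k, g k⌋₊ ≤ n then
      Finset.piAntidiag (Finset.univ : Finset ι) (n - ⌊∑ k, g k⌋₊) else ∅
  have hS : ∀ g f, (⟨g, f⟩ : Σ _ : ι → ℝ, ι → ℕ) ∈ S ↔
      g ∈ weightBox v ∧ ⌊∑ k, g k⌋₊ + ∑ k, f k = n := fun g f => by
    simp only [S, Finset.mem_sigma, hBm]
    refine and_congr_right fun _ => ?_
    split_ifs with hle
    · simp only [Finset.mem_piAntidiag, Finset.mem_univ, implies_true, and_true]
      change ∑ k, f k = _ ↔ _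
      omega
    · simp only [Finset.notMem_empty, false_iff]
      omega
  let F : (Σ _ : ι → ℝ, ι → ℕ) → ι → ℝ := fun p k => p.1 k + p.2 k
  have himg : weightSlice v n = (S.image F : Finset (ι → ℝ)) := by
    ext α
    simp only [Finset.coe_image, Set.mem_image, Finset.mem_coe]
    constructor
    · rintro ⟨hα, h0, h1⟩
      have hbox := fract_mem_weightBox hv hα
      have hfl : ∀ k, Int.fract (α k) + (⌊α k⌋₊ : ℝ) = α k := fun k => by
        rw [natCast_floor_eq_intCast_floor (h0 k), Int.fract_add_floor]
      refine ⟨⟨fun k => Int.fract (α k), fun k => ⌊α k⌋₊⟩, (hS _ _).2 ⟨hbox, ?_⟩, funext hfl⟩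
      have : ((⌊∑ k, Int.fract (α k)⌋₊ + ∑ k, ⌊α k⌋₊ : ℕ) : ℝ) = n := by
        rw [Nat.cast_add, natCast_floor_sum_of_mem_weightBox hbox, Nat.cast_sum,
          ← Finset.sum_add_distrib, ← h1]
        exact Finset.sum_congr rfl fun k _ => hfl k
      exact_mod_cast this
    · rintro ⟨⟨g, f⟩, hgf, rfl⟩
      obtain ⟨hg, hn⟩ := (hS _ _).1 hgf
      refine ⟨(weightLattice v).add_mem hg.1
        (by simpa using intCast_mem_weightLattice hv fun k => (f k : ℤ)),
        fun k => add_nonneg (hg.2 k).1 (Nat.cast_nonneg _), ?_⟩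
      simp only [F, Finset.sum_add_distrib]
      rw [← natCast_floor_sum_of_mem_weightBox hg, ← hn]
      push_cast
      rfl
  rw [himg, Set.ncard_coe_finset, Finset.card_image_of_injOn, Finset.card_sigma]
  · exact Finset.sum_congr rfl fun g _ => by split_ifs <;> simp
  · rintro ⟨g, f⟩ hp ⟨g', f'⟩ hp' hF
    have hg := ((hS _ _).1 hp).1.2
    have hg' := ((hS _ _).1 hp').1.2
    have hk : ∀ k, g k = g' k ∧ f k = f' k := fun k => by
      have e : g k + f k = g' k + f' k := congrFun hF k
      have e1 : Int.fract (g k + f k) = g k := by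
        rw [Int.fract_add_natCast, Int.fract_eq_self.2 (hg k)]
      have e2 : Int.fract (g' k + f' k) = g' k := by
        rw [Int.fract_add_natCast, Int.fract_eq_self.2 (hg' k)]
      have e3 : g k = g' k := by rw [← e1, e, e2]
      exact ⟨e3, by rw [e3] at e; exact_mod_cast add_left_cancel e⟩
    obtain rfl : g = g' := funext fun k => (hk k).1
    obtain rfl : f = f' := funext fun k => (hk k).2
    rfl

theorem card_piAntidiag_univ_fin (d n : ℕ) :
    (Finset.piAntidiag (Finset.univ : Finset (Fin (d + 1))) n).card = (d + n).choose d := by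
  rw [← Finset.map_sym_eq_piAntidiag, Finset.card_map, Finset.sym_univ, Finset.card_univ,
    Sym.card_sym_eq_multichoose, Fintype.card_fin, Nat.multichoose_eq,
    show d + 1 + n - 1 = d + n by omega, Nat.choose_symm_add]

/-- The δ-vector of an integral simplex counts the elements of the weight box by total weight. -/
theorem deltaVector_simplexBody {N d : ℕ} (s : Affine.Simplex ℝ (Fin N → ℝ) d)
    (hs : IsIntegralSimplex s) (j : Fin (d + 1)) :
    deltaVector d (simplexBody s) j =
      ({α ∈ weightBox s.points | ∑ k, α k = (j : ℕ)}.ncard : ℤ) := by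
  classical
  have hfin := weightBox_finite s.independent
  set B := hfin.toFinset
  have hB : (B : Set (Fin (d + 1) → ℝ)) = weightBox s.points := hfin.coe_toFinset
  have hseries : (PowerSeries.mk fun n => (ehrhartCount (simplexBody s) n : ℤ)) =
      ∑ g ∈ B, PowerSeries.X ^ ⌊∑ k, g k⌋₊ *
        PowerSeries.mk (fun n => ((d + n).choose d : ℤ)) := by
    ext n
    rw [PowerSeries.coeff_mk, simplexBody, ehrhartCount_convexHull_range s.independent,
      ncard_weightSlice hs B hB, map_sum]
    push_cast
    refine Finset.sum_congr rfl fun g _ => ?_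
    rw [PowerSeries.coeff_X_pow_mul', PowerSeries.coeff_mk, card_piAntidiag_univ_fin]
  have hone : (PowerSeries.mk fun n => ((d + n).choose d : ℤ)) * (1 - PowerSeries.X) ^ (d + 1) = 1 :=
    PowerSeries.mk_add_choose_mul_one_sub_pow_eq_one ℤ d
  have hprod : (1 - PowerSeries.X) ^ (d + 1) *
      PowerSeries.mk (fun n => (ehrhartCount (simplexBody s) n : ℤ)) =
      ∑ g ∈ B, (PowerSeries.X ^ ⌊∑ k, g k⌋₊ : PowerSeries ℤ) := by
    rw [hseries, Finset.mul_sum]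
    refine Finset.sum_congr rfl fun g _ => ?_
    rw [mul_left_comm, mul_comm ((1 - PowerSeries.X) ^ (d + 1)), hone, mul_one]
  rw [deltaVector, hprod, map_sum]
  simp only [PowerSeries.coeff_X_pow]
  rw [Finset.sum_boole]
  have : {α ∈ weightBox s.points | ∑ k, α k = (j : ℕ)} =
      ((B.filter fun g => (j : ℕ) = ⌊∑ k, g k⌋₊ : Finset _) : Set (Fin (d + 1) → ℝ)) := by
    ext α
    rw [Finset.coe_filter]
    simp only [Set.mem_ofPred_eq, ← Finset.mem_coe, hB]
    refine and_congr_right fun hα => ?_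
    rw [eq_comm (a := (j : ℕ)), ← Nat.cast_inj (R := ℝ),
      natCast_floor_sum_of_mem_weightBox hα]
  rw [this, Set.ncard_coe_finset]

/-! ### Weight boxes of prime cardinality -/

/-- A box element has total weight less than `d + 1`, so the entries of the δ-vector exhaust
the box. -/
theorem sum_deltaVector_simplexBody {N d : ℕ} (s : Affine.Simplex ℝ (Fin N → ℝ) d)
    (hs : IsIntegralSimplex s) :
    ∑ j, deltaVector d (simplexBody s) j = ((weightBox s.points).ncard : ℤ) := by
  classical
  have hfin := weightBox_finite s.independent
  have hB : ∀ α, α ∈ hfin.toFinset ↔ α ∈ weightBox s.points := fun α => hfin.mem_toFinset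
  have hlt : ∀ α ∈ weightBox s.points, ⌊∑ k, α k⌋₊ < d + 1 := fun α hα => by
    rw [Nat.floor_lt (Finset.sum_nonneg fun k _ => (hα.2 k).1)]
    have := Finset.sum_lt_sum_of_nonempty (Finset.univ_nonempty (α := Fin (d + 1)))
      fun k _ => (hα.2 k).2
    simpa using this
  simp only [deltaVector_simplexBody s hs]
  rw [Set.ncard_eq_toFinset_card _ hfin, Finset.card_eq_sum_card_fiberwise
    (f := fun α => Fin.ofNat (d + 1) ⌊∑ k, α k⌋₊) (t := Finset.univ) (by simp)]
  push_cast
  refine Finset.sum_congr rfl fun j _ => ?_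
  rw [← Set.ncard_coe_finset]
  congr 2
  ext α
  simp only [Finset.coe_filter, Set.mem_ofPred_eq, hB]
  refine and_congr_right fun hα => ?_
  rw [← natCast_floor_sum_of_mem_weightBox hα, Nat.cast_inj, Nat.floor_natCast, Fin.ext_iff, Fin.val_ofNat,
    Nat.mod_eq_of_lt (hlt α hα)]

/-- The weights `((m a_k) mod p) / p`, where residues are taken in `{0, …, p - 1}`. -/
noncomputable def residueWeights {ι : Type*} {p : ℕ} (a : ι → ZMod p) (m : ZMod p) : ι → ℝ :=
  fun k => ((m * a k).val : ℝ) / p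

/-- The total of the weights `residueWeights a m`, rounded down; it is an integer already
if `∑ k, a k = 0`. -/
def residueHeight {ι : Type*} [Fintype ι] {p : ℕ} (a : ι → ZMod p) (m : ZMod p) : ℕ :=
  (∑ k, (m * a k).val) / p

section Residues

variable {ι : Type*} {p : ℕ} [Fact p.Prime]

theorem residueWeights_mem_Ico (a : ι → ZMod p) (m : ZMod p) (k : ι) :
    0 ≤ residueWeights a m k ∧ residueWeights a m k < 1 := by
  have hp : (0 : ℝ) < p := Nat.cast_pos.2 (NeZero.pos p)
  refine ⟨by unfold residueWeights; positivity, ?_⟩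
  rw [residueWeights, div_lt_one hp, Nat.cast_lt]
  exact ZMod.val_lt _

theorem residueWeights_injective {a : ι → ZMod p} (ha : a ≠ 0) :
    Function.Injective (residueWeights a) := by
  intro m m' h
  obtain ⟨k, hk⟩ := Function.ne_iff.1 ha
  have hp : (p : ℝ) ≠ 0 := Nat.cast_ne_zero.2 (NeZero.ne p)
  have h1 := congrFun h k
  simp only [residueWeights] at h1
  rw [div_left_inj' hp, Nat.cast_inj] at h1
  exact mul_right_cancel₀ hk (ZMod.val_injective p h1)

variable [Fintype ι]

theorem mul_residueHeight {a : ι → ZMod p} (ha : ∑ k, a k = 0) (m : ZMod p) :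
    p * residueHeight a m = ∑ k, (m * a k).val := by
  refine Nat.mul_div_cancel' ((ZMod.natCast_eq_zero_iff _ _).1 ?_)
  rw [Nat.cast_sum]
  simp [← Finset.mul_sum, ha]

theorem sum_residueWeights {a : ι → ZMod p} (ha : ∑ k, a k = 0) (m : ZMod p) :
    ∑ k, residueWeights a m k = residueHeight a m := by
  have hp : (p : ℝ) ≠ 0 := Nat.cast_ne_zero.2 (NeZero.ne p)
  simp only [residueWeights]
  rw [← Finset.sum_div, div_eq_iff hp, mul_comm]
  exact_mod_cast (mul_residueHeight ha m).symm

theorem residueHeight_lt_card [Nonempty ι] {a : ι → ZMod p} (ha : ∑ k, a k = 0) (m : ZMod p) :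
    residueHeight a m < Fintype.card ι := by
  refine Nat.lt_of_mul_lt_mul_left (a := p) ?_
  rw [mul_residueHeight ha]
  calc ∑ k, (m * a k).val < ∑ _k : ι, p :=
        Finset.sum_lt_sum_of_nonempty Finset.univ_nonempty fun k _ => ZMod.val_lt _
    _ = p * Fintype.card ι := by simp [mul_comm]

theorem residueHeight_zero (a : ι → ZMod p) : residueHeight a 0 = 0 := by
  simp [residueHeight]

theorem residueHeight_add_le {a : ι → ZMod p} (ha : ∑ k, a k = 0) (m m' : ZMod p) :
    residueHeight a (m + m') ≤ residueHeight a m + residueHeight a m' := by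
  refine Nat.le_of_mul_le_mul_left ?_ (NeZero.pos p)
  rw [mul_add, mul_residueHeight ha, mul_residueHeight ha, mul_residueHeight ha,
    ← Finset.sum_add_distrib]
  refine Finset.sum_le_sum fun k _ => ?_
  rw [add_mul]
  exact ZMod.val_add_le _ _

/-- The residues of `m a_k` and `-m a_k` add up to `p` unless `a_k = 0`. -/
theorem residueHeight_add_neg {a : ι → ZMod p} (ha : ∑ k, a k = 0) {m : ZMod p} (hm : m ≠ 0) :
    residueHeight a m + residueHeight a (-m) = (Finset.univ.filter fun k => a k ≠ 0).card := by
  refine Nat.eq_of_mul_eq_mul_left (NeZero.pos p) ?_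
  rw [mul_add, mul_residueHeight ha, mul_residueHeight ha, ← Finset.sum_add_distrib,
    Finset.card_filter, Finset.mul_sum]
  refine Finset.sum_congr rfl fun k _ => ?_
  have hlt := ZMod.val_lt (m * a k)
  by_cases hk : a k = 0
  · simp [hk]
  · rw [neg_mul, ZMod.neg_val, if_neg (mul_ne_zero hm hk), if_pos hk]
    omega

/-- If the weight box consists of the multiples of the residues `a`, then the box elements of
total weight `j` correspond to the multipliers of height `j`. -/
theorem ncard_weightBox_sum_eq {N : ℕ} {v : ι → Fin N → ℝ} {a : ι → ZMod p} (ha : a ≠ 0)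
    (hsum : ∑ k, a k = 0) (hbox : weightBox v = Set.range (residueWeights a)) (j : ℕ) :
    {α ∈ weightBox v | ∑ k, α k = j}.ncard =
      (Finset.univ.filter fun m => residueHeight a m = j).card := by
  classical
  rw [← Set.ncard_coe_finset, ← Set.ncard_image_of_injective _ (residueWeights_injective ha)]
  congr 1
  ext α
  simp only [hbox, Set.mem_ofPred_eq, Set.mem_range, Finset.coe_filter, Finset.mem_univ, true_and,
    Set.mem_image]
  constructor
  · rintro ⟨⟨m, rfl⟩, h⟩
    rw [sum_residueWeights hsum, Nat.cast_inj] at h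
    exact ⟨m, h, rfl⟩
  · rintro ⟨m, h, rfl⟩
    exact ⟨⟨m, rfl⟩, by rw [sum_residueWeights hsum, h]⟩

/-- The cardinality of the weight box annihilates its elements modulo `1`. -/
theorem exists_intCast_eq_ncard_mul_of_mem_weightBox {N : ℕ} {v : ι → Fin N → ℝ}
    (hv : ∀ k j, ∃ z : ℤ, v k j = z) {α : ι → ℝ} (hα : α ∈ weightBox v) (k : ι) :
    ∃ z : ℤ, ((weightBox v).ncard : ℝ) * α k = z := by
  -- The box represents the quotient of the weight lattice by the integer weights, so the order
  -- of this quotient group annihilates every box element modulo the integer weights.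
  let Z : AddSubgroup (ι → ℝ) := AddSubgroup.pi Set.univ fun _ => (Int.castAddHom ℝ).range
  have hZ : ∀ β, β ∈ Z ↔ ∀ k, ∃ z : ℤ, (z : ℝ) = β k := fun β => by
    simp only [Z, AddSubgroup.mem_pi, Set.mem_univ, forall_true_left, AddMonoidHom.mem_range,
      Int.coe_castAddHom]
  let Q := weightLattice v ⧸ Z.addSubgroupOf (weightLattice v)
  let F : weightBox v → Q := fun β => QuotientAddGroup.mk ⟨β.1, β.2.1⟩
  have hF : Function.Bijective F := by
    constructor
    · rintro ⟨β, hβ⟩ ⟨γ, hγ⟩ h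
      have h' := (hZ _).1 (AddSubgroup.mem_addSubgroupOf.1 (QuotientAddGroup.eq.1 h))
      refine Subtype.ext (funext fun k => ?_)
      obtain ⟨z, hz⟩ := h' k
      have : Int.fract (γ k) = Int.fract (β k) := Int.fract_eq_fract.2 ⟨z, by
        rw [hz]
        simp only [AddSubgroup.coe_add, NegMemClass.coe_neg, Pi.add_apply, Pi.neg_apply]
        ring⟩
      rw [Int.fract_eq_self.2 (hβ.2 k), Int.fract_eq_self.2 (hγ.2 k)] at this
      exact this.symm
    · intro q
      obtain ⟨⟨β, hβ⟩, rfl⟩ := QuotientAddGroup.mk_surjective q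
      refine ⟨⟨_, fract_mem_weightBox hv hβ⟩, QuotientAddGroup.eq.2 ?_⟩
      refine AddSubgroup.mem_addSubgroupOf.2 ((hZ _).2 fun k => ⟨⌊β k⌋, ?_⟩)
      simp only [AddSubgroup.coe_add, NegMemClass.coe_neg, Pi.add_apply, Pi.neg_apply]
      rw [← Int.self_sub_fract]
      ring
  have hcard : Nat.card Q = (weightBox v).ncard := by
    rw [← Nat.card_congr (Equiv.ofBijective F hF), Nat.card_coe_set_eq]
  have h0 : (weightBox v).ncard • (QuotientAddGroup.mk ⟨α, hα.1⟩ : Q) = 0 := by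
    rw [← hcard, card_nsmul_eq_zero']
  rw [← QuotientAddGroup.mk_nsmul, QuotientAddGroup.eq_zero_iff, AddSubgroup.mem_addSubgroupOf,
    hZ] at h0
  obtain ⟨z, hz⟩ := h0 k
  exact ⟨z, by rw [hz]; simp⟩

theorem residueWeights_mem_weightBox {N : ℕ} {v : ι → Fin N → ℝ}
    (hv : ∀ k j, ∃ z : ℤ, v k j = z) {a : ι → ZMod p} (h : residueWeights a 1 ∈ weightLattice v)
    (m : ZMod p) : residueWeights a m ∈ weightBox v := by
  refine ⟨?_, residueWeights_mem_Ico a m⟩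
  have hp : (p : ℝ) ≠ 0 := Nat.cast_ne_zero.2 (NeZero.ne p)
  -- `m * a k` and the product of the representatives differ by a multiple of `p`.
  have hdiv : ∀ k, ∃ z : ℤ, ((m * a k).val : ℤ) - m.val * (a k).val = p * z := fun k => by
    rw [← dvd_def, ← ZMod.intCast_zmod_eq_zero_iff_dvd]
    simp
  choose z hz using hdiv
  have : residueWeights a m = m.val • residueWeights a 1 + fun k => (z k : ℝ) := by
    funext k
    have hk : ((m * a k).val : ℝ) = m.val * (a k).val + p * z k := by
      rw [← sub_eq_iff_eq_add']
      exact_mod_cast hz k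
    rw [Pi.add_apply, Pi.smul_apply, nsmul_eq_mul]
    simp only [residueWeights, one_mul, hk]
    field_simp
  rw [this]
  exact (weightLattice v).add_mem ((weightLattice v).nsmul_mem h _)
    (intCast_mem_weightLattice hv z)

theorem sum_eq_zero_of_residueWeights_mem {N : ℕ} {v : ι → Fin N → ℝ} {a : ι → ZMod p}
    (h : residueWeights a 1 ∈ weightLattice v) : ∑ k, a k = 0 := by
  have hp : (p : ℝ) ≠ 0 := Nat.cast_ne_zero.2 (NeZero.ne p)
  obtain ⟨z, hz⟩ := h.1
  simp only [residueWeights, one_mul] at hz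
  rw [← Finset.sum_div, div_eq_iff hp] at hz
  have h1 : ((∑ k, (a k).val : ℕ) : ℤ) = z * p := by exact_mod_cast hz
  have h2 := congrArg (Int.cast : ℤ → ZMod p) h1
  simpa using h2

/-- If the weight box of an integral configuration has prime cardinality `p`, it is a cyclic
group of order `p` and consists of the multiples of a single residue vector. -/
theorem exists_weightBox_eq_range_residueWeights {N : ℕ} {v : ι → Fin N → ℝ}
    (hv : ∀ k j, ∃ z : ℤ, v k j = z) (hcard : (weightBox v).ncard = p) :
    ∃ a : ι → ZMod p, a ≠ 0 ∧ ∑ k, a k = 0 ∧ weightBox v = Set.range (residueWeights a) := by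
  have hp : (p : ℝ) ≠ 0 := Nat.cast_ne_zero.2 (NeZero.ne p)
  have hfin : (weightBox v).Finite := Set.finite_of_ncard_ne_zero (hcard ▸ NeZero.ne p)
  obtain ⟨α, hα, hα0⟩ := Set.exists_ne_of_one_lt_ncard
    (hcard ▸ (Fact.out : p.Prime).one_lt) (0 : ι → ℝ)
  have hex : ∀ k, ∃ n : ℕ, n < p ∧ (p : ℝ) * α k = n := fun k => by
    obtain ⟨z, hz⟩ := exists_intCast_eq_ncard_mul_of_mem_weightBox hv hα k
    rw [hcard] at hz
    have h0 : 0 ≤ (p : ℝ) * α k := mul_nonneg p.cast_nonneg (hα.2 k).1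
    have h1 : (p : ℝ) * α k < p :=
      mul_lt_of_lt_one_right (Nat.cast_pos.2 (NeZero.pos p)) (hα.2 k).2
    rw [hz] at h0 h1 ⊢
    lift z to ℕ using by exact_mod_cast h0
    exact ⟨z, by exact_mod_cast h1, rfl⟩
  choose n hn hnα using hex
  have hrw : residueWeights (fun k => (n k : ZMod p)) 1 = α := by
    funext k
    rw [residueWeights, one_mul, ZMod.val_natCast, Nat.mod_eq_of_lt (hn k), ← hnα]
    field_simp
  have hmem : residueWeights (fun k => (n k : ZMod p)) 1 ∈ weightLattice v := hrw ▸ hα.1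
  have ha : (fun k => (n k : ZMod p)) ≠ 0 := by
    intro h
    apply hα0
    rw [← hrw, h]
    funext k
    simp [residueWeights]
  refine ⟨_, ha, sum_eq_zero_of_residueWeights_mem hmem, Eq.symm ?_⟩
  refine Set.eq_of_subset_of_ncard_le ?_ ?_ hfin
  · rintro _ ⟨m, rfl⟩
    exact residueWeights_mem_weightBox hv hmem m
  · rw [hcard, ← Set.image_univ, Set.ncard_image_of_injective _ (residueWeights_injective ha),
      Set.ncard_univ, Nat.card_zmod]

end Residues

/-! ### Sorted values of a function on a cyclic group of prime order -/

/-- Position of a value in a nondecreasing sequence, in terms of a count. -/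
theorem MonotoneOn.le_iff_le_card_filter {n : ℕ} {i : ℕ → ℕ}
    (hi : MonotoneOn i (Set.Icc 1 n)) {k : ℕ} (hk : k ∈ Set.Icc 1 n) (t : ℕ) :
    i k ≤ t ↔ k ≤ ((Finset.Icc 1 n).filter fun l => i l ≤ t).card := by
  obtain ⟨hk1, hkn⟩ := hk
  constructor
  · intro h
    calc k = (Finset.Icc 1 k).card := by simp
      _ ≤ _ := Finset.card_le_card fun l hl => by
        rw [Finset.mem_Icc] at hl
        rw [Finset.mem_filter, Finset.mem_Icc]
        exact ⟨⟨hl.1, hl.2.trans hkn⟩,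
          (hi ⟨hl.1, hl.2.trans hkn⟩ ⟨hk1, hkn⟩ hl.2).trans h⟩
  · contrapose!
    intro h
    calc _ ≤ (Finset.Icc 1 (k - 1)).card := Finset.card_le_card fun l hl => by
          rw [Finset.mem_filter, Finset.mem_Icc] at hl
          rw [Finset.mem_Icc]
          refine ⟨hl.1.1, ?_⟩
          by_contra hlk
          have := hi ⟨hk1, hkn⟩ hl.1 (by omega : k ≤ l)
          omega
      _ < k := by simp; omega

section Ranks

variable {p : ℕ} [Fact p.Prime] {h : ZMod p → ℕ} {i : ℕ → ℕ}

theorem le_iff_lt_card_filter_of_card_eq (hi : MonotoneOn i (Set.Icc 1 (p - 1)))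
    (hcount : ∀ t, (Finset.univ.filter fun m => h m ≤ t).card =
      1 + ((Finset.Icc 1 (p - 1)).filter fun k => i k ≤ t).card)
    {k : ℕ} (hk : k ∈ Set.Icc 1 (p - 1)) (t : ℕ) :
    i k ≤ t ↔ k < (Finset.univ.filter fun m => h m ≤ t).card := by
  rw [hi.le_iff_le_card_filter hk, hcount]
  omega

/-- The sorted values of a subadditive function on `ℤ/pℤ` are subadditive in their positions:
by the Cauchy-Davenport theorem, sums of the `k + 1` smallest and the `l + 1` smallest arguments
take at least `k + l + 1` values. -/
theorem sorted_add_le (hi : MonotoneOn i (Set.Icc 1 (p - 1)))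
    (hcount : ∀ t, (Finset.univ.filter fun m => h m ≤ t).card =
      1 + ((Finset.Icc 1 (p - 1)).filter fun k => i k ≤ t).card)
    (hadd : ∀ m m', h (m + m') ≤ h m + h m')
    {k l : ℕ} (hk : 1 ≤ k) (hl : 1 ≤ l) (hkl : k + l ≤ p - 1) : i (k + l) ≤ i k + i l := by
  classical
  rw [le_iff_lt_card_filter_of_card_eq hi hcount ⟨by omega, hkl⟩]
  have hA := (le_iff_lt_card_filter_of_card_eq hi hcount ⟨hk, by omega⟩ (i k)).1 le_rfl
  have hB := (le_iff_lt_card_filter_of_card_eq hi hcount ⟨hl, by omega⟩ (i l)).1 le_rfl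
  have hCD := ZMod.cauchy_davenport (Fact.out : p.Prime)
    (Finset.card_pos.1 (Nat.zero_lt_of_lt hA)) (Finset.card_pos.1 (Nat.zero_lt_of_lt hB))
  open scoped Pointwise in
  have hsub : (Finset.univ.filter fun m => h m ≤ i k) + (Finset.univ.filter fun m => h m ≤ i l) ⊆
      Finset.univ.filter fun m => h m ≤ i k + i l := by
    intro x hx
    obtain ⟨m, hm, m', hm', rfl⟩ := Finset.mem_add.1 hx
    rw [Finset.mem_filter] at hm hm' ⊢
    exact ⟨Finset.mem_univ _, (hadd m m').trans (add_le_add hm.2 hm'.2)⟩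
  have := hCD.trans (Finset.card_le_card hsub)
  have := (Fact.out : p.Prime).two_le
  omega

/-- If opposite arguments have values of constant sum, so do opposite positions. -/
theorem sorted_add_sorted_sub (hi : MonotoneOn i (Set.Icc 1 (p - 1)))
    (hcount : ∀ t, (Finset.univ.filter fun m => h m ≤ t).card =
      1 + ((Finset.Icc 1 (p - 1)).filter fun k => i k ≤ t).card)
    (h0 : h 0 = 0) (hpos : ∀ k ∈ Set.Icc 1 (p - 1), 1 ≤ i k) {s : ℕ}
    (hs : ∀ m, m ≠ 0 → h m + h (-m) = s) {k : ℕ} (hk : k ∈ Set.Icc 1 (p - 1)) :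
    i k + i (p - k) = s := by
  classical
  obtain ⟨hk1, hk2⟩ := hk
  have hcard : (Finset.univ : Finset (ZMod p)).card = p := by
    rw [Finset.card_univ, ZMod.card]
  have hneg : ∀ B : Finset (ZMod p), (B.image Neg.neg).card = B.card := fun B =>
    Finset.card_image_of_injective _ neg_injective
  have rank := fun {k : ℕ} (hk : k ∈ Set.Icc 1 (p - 1)) (t : ℕ) =>
    le_iff_lt_card_filter_of_card_eq hi hcount hk t
  have hk' : p - k ∈ Set.Icc 1 (p - 1) := ⟨by omega, by omega⟩
  apply le_antisymm
  · -- At least `p - k` arguments have value at least `i k`, at least `k` have value at least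
    -- `i (p - k)`, and all of these are nonzero: some `m` is of the first kind with `-m` of the
    -- second.
    have key : ∀ l ∈ Set.Icc 1 (p - 1), p - l ≤ (Finset.univ.filter fun m => i l ≤ h m).card ∧
        ∀ m ∈ Finset.univ.filter (fun m => i l ≤ h m), m ≠ 0 := fun l hl => by
      constructor
      · have h1 := (rank hl (i l - 1)).not.1 (by have := hpos l hl; omega)
        have h2 := Finset.card_filter_add_card_filter_not (s := (Finset.univ : Finset (ZMod p)))
          (fun m => h m ≤ i l - 1)
        have h3 : (Finset.univ.filter fun m => ¬ h m ≤ i l - 1) =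
            Finset.univ.filter fun m => i l ≤ h m := by
          refine Finset.filter_congr fun m _ => ?_
          have := hpos l hl
          omega
        rw [h3] at h2
        omega
      · rintro m hm rfl
        rw [Finset.mem_filter, h0] at hm
        have := hpos l hl
        omega
    obtain ⟨hC, hC0⟩ := key k ⟨hk1, hk2⟩
    obtain ⟨hD, hD0⟩ := key (p - k) hk'
    have hcap : ((Finset.univ.filter fun m => i k ≤ h m) ∩
        ((Finset.univ.filter fun m => i (p - k) ≤ h m).image Neg.neg)).Nonempty := by
      rw [← Finset.card_pos]
      have hle : ((Finset.univ.filter fun m => i k ≤ h m) ∪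
          ((Finset.univ.filter fun m => i (p - k) ≤ h m).image Neg.neg)).card ≤ p - 1 := by
        have : ((Finset.univ : Finset (ZMod p)).erase 0).card = p - 1 := by
          rw [Finset.card_erase_of_mem (Finset.mem_univ _), hcard]
        rw [← this]
        refine Finset.card_le_card fun m hm => Finset.mem_erase.2 ⟨?_, Finset.mem_univ _⟩
        rcases Finset.mem_union.1 hm with hm | hm
        · exact hC0 m hm
        · obtain ⟨m', hm', rfl⟩ := Finset.mem_image.1 hm
          exact neg_ne_zero.2 (hD0 m' hm')
      have := Finset.card_union_add_card_inter (Finset.univ.filter fun m => i k ≤ h m)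
        ((Finset.univ.filter fun m => i (p - k) ≤ h m).image Neg.neg)
      rw [hneg] at this
      omega
    obtain ⟨m, hm⟩ := hcap
    obtain ⟨hm1, hm2⟩ := Finset.mem_inter.1 hm
    obtain ⟨m', hm', rfl⟩ := Finset.mem_image.1 hm2
    have := hs m' (hD0 m' hm')
    rw [Finset.mem_filter] at hm1 hm'
    omega
  · -- At least `k + 1` arguments have value at most `i k` and at least `p - k + 1` have value at
    -- most `i (p - k)`: for two `m`, hence for a nonzero one, `m` is of the first kind and `-m` of
    -- the second.
    have hA := (rank ⟨hk1, hk2⟩ (i k)).1 le_rfl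
    have hB := (rank hk' (i (p - k))).1 le_rfl
    have hcap : 1 < ((Finset.univ.filter fun m => h m ≤ i k) ∩
        ((Finset.univ.filter fun m => h m ≤ i (p - k)).image Neg.neg)).card := by
      have := Finset.card_union_add_card_inter (Finset.univ.filter fun m => h m ≤ i k)
        ((Finset.univ.filter fun m => h m ≤ i (p - k)).image Neg.neg)
      rw [hneg] at this
      have := (Finset.card_le_univ ((Finset.univ.filter fun m => h m ≤ i k) ∪
        ((Finset.univ.filter fun m => h m ≤ i (p - k)).image Neg.neg))).trans_eq (ZMod.card p)
      omega
    obtain ⟨m, hm, hm0⟩ := Finset.exists_mem_ne hcap 0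
    obtain ⟨hm1, hm2⟩ := Finset.mem_inter.1 hm
    obtain ⟨m', hm', rfl⟩ := Finset.mem_image.1 hm2
    have := hs m' (neg_ne_zero.1 hm0)
    rw [Finset.mem_filter] at hm1 hm'
    omega

end Ranks

/-! ### The simplices `P_7(c)` -/

/-- Padding a list with zeros does not change the sum of a function that vanishes at `0`. -/
theorem List.sum_getD_eq_sum_map {f : ℕ → ℕ} (hf : f 0 = 0) (l : List ℕ) (e : ℕ)
    (hl : l.length ≤ e) : ∑ q : Fin e, f (l.getD q 0) = (l.map f).sum := by
  induction l generalizing e with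
  | nil => simp [hf]
  | cons x l ih =>
    cases e with
    | zero => simp at hl
    | succ e =>
      rw [Fin.sum_univ_succ, List.map_cons, List.sum_cons, ← ih e (by simpa using hl)]
      simp

theorem sum_map_lastRowEntries (c : Fin 6 → ℕ) (f : ℕ → ℕ) :
    ((lastRowEntries c).map f).sum = ∑ j : Fin 6, c j * f (j + 1) := by
  simp [lastRowEntries, List.finRange_succ, Fin.sum_univ_succ]

theorem length_lastRowEntries (c : Fin 6 → ℕ) : (lastRowEntries c).length = ∑ j, c j := by
  have := sum_map_lastRowEntries c fun _ => 1
  simpa using this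

section VerticesP7

variable {e : ℕ} {c : Fin 6 → ℕ}

theorem verticesP7_integral {d : ℕ} (k : Fin (d + 1)) (j : Fin d) :
    ∃ z : ℤ, verticesP7 d c k j = z := by
  refine Fin.cases ⟨0, by simp [verticesP7]⟩ (fun r => ⟨matrixA7 d c r j, ?_⟩) k
  simp [verticesP7]

theorem matrixA7_castSucc (r : Fin e) (j : Fin (e + 1)) :
    matrixA7 (e + 1) c r.castSucc j = if j = r.castSucc then 1 else 0 := by
  have := r.isLt
  rw [matrixA7, if_neg]
  simp only [Fin.val_castSucc]
  omega

theorem matrixA7_last (j : Fin (e + 1)) :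
    matrixA7 (e + 1) c (Fin.last e) j =
      if j = Fin.last e then 7 else (((lastRowEntries c).getD (j : ℕ) 0 : ℕ) : ℤ) := by
  rw [matrixA7, if_pos (by simp)]

theorem sum_mul_verticesP7_castSucc (α : Fin (e + 2) → ℝ) (q : Fin e) :
    ∑ k, α k * verticesP7 (e + 1) c k q.castSucc =
      α q.castSucc.succ + α (Fin.last (e + 1)) * ((lastRowEntries c).getD (q : ℕ) 0 : ℕ) := by
  rw [Fin.sum_univ_succ, Fin.sum_univ_castSucc]
  simp [verticesP7, matrixA7_castSucc, matrixA7_last, (Fin.castSucc_lt_last q).ne]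

theorem sum_mul_verticesP7_last (α : Fin (e + 2) → ℝ) :
    ∑ k, α k * verticesP7 (e + 1) c k (Fin.last e) = α (Fin.last (e + 1)) * 7 := by
  rw [Fin.sum_univ_succ, Fin.sum_univ_castSucc]
  simp [verticesP7, matrixA7_castSucc, matrixA7_last, (Fin.castSucc_lt_last _).ne']

theorem affineIndependent_verticesP7 : AffineIndependent ℝ (verticesP7 (e + 1) c) := by
  rw [affineIndependent_iff_of_fintype]
  intro w hw hwv
  rw [Finset.univ.weightedVSub_eq_linear_combination hw] at hwv
  have hcoord : ∀ j, ∑ k, w k * verticesP7 (e + 1) c k j = 0 := fun j => by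
    simpa using congrFun hwv j
  have hlast : w (Fin.last (e + 1)) = 0 := by
    simpa [sum_mul_verticesP7_last] using hcoord (Fin.last e)
  have hmid : ∀ q : Fin e, w q.castSucc.succ = 0 := fun q => by
    simpa [sum_mul_verticesP7_castSucc, hlast] using hcoord q.castSucc
  have hzero : w 0 = 0 := by
    rwa [Fin.sum_univ_succ, Fin.sum_univ_castSucc, Fin.succ_last, hlast,
      Finset.sum_eq_zero fun q _ => hmid q, add_zero, add_zero] at hw
  exact Fin.cases hzero (Fin.lastCases hlast hmid)

/-- The residue vector generating the weight box of `P_7(c)`: the vertex with last coordinate `7`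
has weight `1/7`, the weights of the unit vectors cancel its other coordinates modulo `1`, and the
weight of the origin makes the total integral. -/
def generatorP7 (e : ℕ) (c : Fin 6 → ℕ) : Fin (e + 2) → ZMod 7 :=
  Fin.cons (∑ q : Fin e, (((lastRowEntries c).getD (q : ℕ) 0 : ℕ) : ZMod 7) - 1)
    (Fin.snoc (α := fun _ => ZMod 7)
      (fun q : Fin e => -(((lastRowEntries c).getD (q : ℕ) 0 : ℕ) : ZMod 7)) 1)

theorem generatorP7_zero : generatorP7 e c 0 =
    ∑ q : Fin e, (((lastRowEntries c).getD (q : ℕ) 0 : ℕ) : ZMod 7) - 1 := rfl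

theorem generatorP7_castSucc_succ (q : Fin e) : generatorP7 e c q.castSucc.succ =
    -(((lastRowEntries c).getD (q : ℕ) 0 : ℕ) : ZMod 7) := by
  rw [generatorP7, Fin.cons_succ, Fin.snoc_castSucc]

theorem generatorP7_last : generatorP7 e c (Fin.last (e + 1)) = 1 := by
  rw [generatorP7, ← Fin.succ_last, Fin.cons_succ, Fin.snoc_last]

theorem sum_generatorP7 : ∑ k, generatorP7 e c k = 0 := by
  rw [Fin.sum_univ_succ, Fin.sum_univ_castSucc]
  simp only [generatorP7_zero, generatorP7_castSucc_succ, Fin.succ_last, generatorP7_last,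
    Finset.sum_neg_distrib]
  ring

/-- The primality of `7`, which makes `ZMod 7` a field. -/
instance fact_prime_seven : Fact (Nat.Prime 7) := ⟨by norm_num⟩

theorem generatorP7_ne_zero : generatorP7 e c ≠ 0 := by
  intro h
  have := congrFun h (Fin.last (e + 1))
  rw [generatorP7_last] at this
  exact one_ne_zero this

theorem residueWeights_generatorP7_mem :
    residueWeights (generatorP7 e c) 1 ∈ weightLattice (verticesP7 (e + 1) c) := by
  have hlast : residueWeights (generatorP7 e c) 1 (Fin.last (e + 1)) = 1 / 7 := by
    rw [residueWeights, generatorP7_last, one_mul, ZMod.val_one]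
    norm_num
  refine ⟨⟨_, by rw [sum_residueWeights sum_generatorP7]; exact (Int.cast_natCast _).symm⟩,
    fun j => Fin.lastCases ?_ (fun q => ?_) j⟩
  · exact ⟨1, by rw [sum_mul_verticesP7_last, hlast]; norm_num⟩
  · rw [sum_mul_verticesP7_castSucc, hlast, residueWeights, generatorP7_castSucc_succ, one_mul]
    set x := (lastRowEntries c).getD (q : ℕ) 0
    have hdvd : (7 : ℕ) ∣ (-(x : ZMod 7)).val + x := by
      rw [← ZMod.natCast_eq_zero_iff]
      simp
    obtain ⟨z, hz⟩ := hdvd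
    have hz' : ((-(x : ZMod 7)).val : ℝ) + x = 7 * z := by exact_mod_cast hz
    refine ⟨z, ?_⟩
    push_cast
    linarith

/-- A box element is determined by its weight at the last vertex, which is a multiple of `1/7`. -/
theorem weightBox_verticesP7 :
    weightBox (verticesP7 (e + 1) c) = Set.range (residueWeights (generatorP7 e c)) := by
  have hmem := residueWeights_mem_weightBox (fun k j => verticesP7_integral k j)
    (residueWeights_generatorP7_mem (e := e) (c := c))
  refine Set.Subset.antisymm (fun α hα => ?_) (Set.range_subset_iff.2 hmem)
  obtain ⟨z, hz⟩ := hα.1.2 (Fin.last e)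
  rw [sum_mul_verticesP7_last] at hz
  obtain ⟨h0, h1⟩ := hα.2 (Fin.last (e + 1))
  have hz0 : (0 : ℝ) ≤ z := by linarith
  lift z to ℕ using by exact_mod_cast hz0
  have hz7 : z < 7 := by
    have : ((z : ℤ) : ℝ) < 7 := by linarith
    exact_mod_cast this
  refine ⟨(z : ZMod 7), ?_⟩
  -- The difference of the two weights lies in the weight lattice and vanishes at the last vertex,
  -- so all its entries are integers of absolute value less than `1`.
  set β := residueWeights (generatorP7 e c) (z : ZMod 7) with hβ
  have hβ' := hmem (z : ZMod 7)
  have hlast : (β - α) (Fin.last (e + 1)) = 0 := by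
    rw [Pi.sub_apply, hβ, residueWeights, generatorP7_last, mul_one, ZMod.val_natCast,
      Nat.mod_eq_of_lt hz7]
    push_cast at hz ⊢
    linarith
  have hdiff := (weightLattice _).sub_mem hβ'.1 hα.1
  have hsmall : ∀ k, (∃ y : ℤ, (β - α) k = y) → (β - α) k = 0 := by
    rintro k ⟨y, hy⟩
    have h1 := hβ'.2 k
    have h2 := hα.2 k
    rw [Pi.sub_apply] at hy
    have ha : (y : ℝ) < 1 := by linarith
    have hb : (-1 : ℝ) < y := by linarith
    have ha' : y < 1 := by exact_mod_cast ha
    have hb' : -1 < y := by exact_mod_cast hb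
    rw [Pi.sub_apply, hy, show y = 0 by omega, Int.cast_zero]
  have hmid : ∀ q : Fin e, (β - α) q.castSucc.succ = 0 := fun q => hsmall _ (by
    obtain ⟨y, hy⟩ := hdiff.2 q.castSucc
    rw [sum_mul_verticesP7_castSucc, hlast, zero_mul, add_zero] at hy
    exact ⟨y, hy⟩)
  have hzero : (β - α) 0 = 0 := hsmall _ (by
    obtain ⟨y, hy⟩ := hdiff.1
    rw [Fin.sum_univ_succ, Fin.sum_univ_castSucc, Fin.succ_last, hlast,
      Finset.sum_eq_zero fun q _ => hmid q, add_zero, add_zero] at hy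
    exact ⟨y, hy⟩)
  rw [← sub_eq_zero]
  funext k
  refine Fin.cases hzero (fun r => Fin.lastCases ?_ hmid r) k
  rw [Fin.succ_last, hlast, Pi.zero_apply]

/-- The height of the multiple `m` is obtained from the listed parameters by rounding up to
the next multiple of `7`. -/
theorem exists_mul_residueHeight_generatorP7 (hc : ∑ j, c j ≤ e) (m : ZMod 7) :
    ∃ r < 7, 7 * residueHeight (generatorP7 e c) m =
      m.val + ∑ j : Fin 6, c j * (-(m * ((j : ℕ) + 1 : ℕ))).val + r := by
  refine ⟨(m * generatorP7 e c 0).val, ZMod.val_lt _, ?_⟩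
  have hsum := List.sum_getD_eq_sum_map (f := fun x : ℕ => (-(m * (x : ZMod 7))).val) (by simp)
    (lastRowEntries c) e (by rwa [length_lastRowEntries])
  rw [sum_map_lastRowEntries] at hsum
  rw [mul_residueHeight sum_generatorP7, Fin.sum_univ_succ, Fin.sum_univ_castSucc, ← hsum]
  simp only [generatorP7_castSucc_succ, Fin.succ_last, generatorP7_last, mul_neg, mul_one]
  ring

end VerticesP7

/-- If rounding up the six sums below to multiples of `7` gives `7 x₁, …, 7 x₆`, then
`1 + t^x₁ + ⋯ + t^x₆` is the δ-polynomial of `P_7(c₁, …, c₆)`. -/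
theorem realizedByP7_of_heights {d : ℕ} {δ : Fin (d + 1) → ℕ} {x₁ x₂ x₃ x₄ x₅ x₆ : ℕ}
    (hd : 1 ≤ d)
    (hδ : ∀ j : Fin (d + 1), δ j = (if 0 = (j : ℕ) then 1 else 0) +
      (if x₁ = (j : ℕ) then 1 else 0) + (if x₂ = (j : ℕ) then 1 else 0) +
      (if x₃ = (j : ℕ) then 1 else 0) + (if x₄ = (j : ℕ) then 1 else 0) +
      (if x₅ = (j : ℕ) then 1 else 0) + (if x₆ = (j : ℕ) then 1 else 0))
    {c₁ c₂ c₃ c₄ c₅ c₆ : ℤ} (h₁ : 0 ≤ c₁) (h₂ : 0 ≤ c₂) (h₃ : 0 ≤ c₃) (h₄ : 0 ≤ c₄) (h₅ : 0 ≤ c₅)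
    (h₆ : 0 ≤ c₆) (hsum : c₁ + c₂ + c₃ + c₄ + c₅ + c₆ ≤ d - 1)
    (e₁ : 7 * (x₁ : ℤ) - (1 + 6 * c₁ + 5 * c₂ + 4 * c₃ + 3 * c₄ + 2 * c₅ + c₆) ∈ Set.Ico 0 7)
    (e₂ : 7 * (x₂ : ℤ) - (2 + 5 * c₁ + 3 * c₂ + c₃ + 6 * c₄ + 4 * c₅ + 2 * c₆) ∈ Set.Ico 0 7)
    (e₃ : 7 * (x₃ : ℤ) - (3 + 4 * c₁ + c₂ + 5 * c₃ + 2 * c₄ + 6 * c₅ + 3 * c₆) ∈ Set.Ico 0 7)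
    (e₄ : 7 * (x₄ : ℤ) - (4 + 3 * c₁ + 6 * c₂ + 2 * c₃ + 5 * c₄ + c₅ + 4 * c₆) ∈ Set.Ico 0 7)
    (e₅ : 7 * (x₅ : ℤ) - (5 + 2 * c₁ + 4 * c₂ + 6 * c₃ + c₄ + 3 * c₅ + 5 * c₆) ∈ Set.Ico 0 7)
    (e₆ : 7 * (x₆ : ℤ) - (6 + c₁ + 2 * c₂ + 3 * c₃ + 4 * c₄ + 5 * c₅ + 6 * c₆) ∈ Set.Ico 0 7) :
    RealizedByP7 δ ![c₁, c₂, c₃, c₄, c₅, c₆] := by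
  obtain ⟨e, rfl⟩ : ∃ e, d = e + 1 := ⟨d - 1, by omega⟩
  lift c₁ to ℕ using h₁
  lift c₂ to ℕ using h₂
  lift c₃ to ℕ using h₃
  lift c₄ to ℕ using h₄
  lift c₅ to ℕ using h₅
  lift c₆ to ℕ using h₆
  set c : Fin 6 → ℕ := ![c₁, c₂, c₃, c₄, c₅, c₆] with hc
  have hcc : (![(c₁ : ℤ), c₂, c₃, c₄, c₅, c₆] : Fin 6 → ℤ) = fun j => (c j : ℤ) := by
    funext j
    fin_cases j <;> rfl
  have hsum' : ∑ j, c j ≤ e := by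
    simp only [hc, Fin.sum_univ_six, Matrix.cons_val]
    push_cast at hsum
    omega
  have hheight := exists_mul_residueHeight_generatorP7 hsum'
  set h := residueHeight (generatorP7 e c)
  have hval : ∀ m : ZMod 7, ∃ r < 7, 7 * h m = m.val + (c₁ * (-(m * 1)).val +
      c₂ * (-(m * 2)).val + c₃ * (-(m * 3)).val + c₄ * (-(m * 4)).val + c₅ * (-(m * 5)).val +
      c₆ * (-(m * 6)).val) + r := by
    intro m
    obtain ⟨r, hr, hm⟩ := hheight m
    refine ⟨r, hr, ?_⟩
    rw [hm, Fin.sum_univ_six]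
    rfl
  simp only [Set.mem_Ico] at e₁ e₂ e₃ e₄ e₅ e₆
  have hh₁ : h 1 = x₁ := by
    obtain ⟨r, hr, hm⟩ := hval 1
    change 7 * h 1 = 1 + (c₁ * 6 + c₂ * 5 + c₃ * 4 + c₄ * 3 + c₅ * 2 + c₆ * 1) + r at hm
    omega
  have hh₂ : h 2 = x₂ := by
    obtain ⟨r, hr, hm⟩ := hval 2
    change 7 * h 2 = 2 + (c₁ * 5 + c₂ * 3 + c₃ * 1 + c₄ * 6 + c₅ * 4 + c₆ * 2) + r at hm
    omega
  have hh₃ : h 3 = x₃ := by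
    obtain ⟨r, hr, hm⟩ := hval 3
    change 7 * h 3 = 3 + (c₁ * 4 + c₂ * 1 + c₃ * 5 + c₄ * 2 + c₅ * 6 + c₆ * 3) + r at hm
    omega
  have hh₄ : h 4 = x₄ := by
    obtain ⟨r, hr, hm⟩ := hval 4
    change 7 * h 4 = 4 + (c₁ * 3 + c₂ * 6 + c₃ * 2 + c₄ * 5 + c₅ * 1 + c₆ * 4) + r at hm
    omega
  have hh₅ : h 5 = x₅ := by
    obtain ⟨r, hr, hm⟩ := hval 5
    change 7 * h 5 = 5 + (c₁ * 2 + c₂ * 4 + c₃ * 6 + c₄ * 1 + c₅ * 3 + c₆ * 5) + r at hm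
    omega
  have hh₆ : h 6 = x₆ := by
    obtain ⟨r, hr, hm⟩ := hval 6
    change 7 * h 6 = 6 + (c₁ * 1 + c₂ * 2 + c₃ * 3 + c₄ * 4 + c₅ * 5 + c₆ * 6) + r at hm
    omega
  have hh₀ : h 0 = 0 := residueHeight_zero _
  rw [hcc]
  refine ⟨fun j => Int.natCast_nonneg _, ?_, ⟨⟨verticesP7 (e + 1) c, affineIndependent_verticesP7⟩,
    rfl, fun k j => verticesP7_integral k j, fun j => ?_⟩⟩
  · have : ((∑ j, c j : ℕ) : ℤ) ≤ e := by exact_mod_cast hsum'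
    push_cast at this ⊢
    omega
  · rw [deltaVector_simplexBody _ (fun k j => verticesP7_integral k j), Nat.cast_inj]
    rw [ncard_weightBox_sum_eq generatorP7_ne_zero sum_generatorP7 weightBox_verticesP7,
      Finset.card_filter, hδ]
    refine (Fin.sum_univ_seven fun m : Fin 7 =>
      if h (m : ZMod 7) = (j : ℕ) then 1 else 0).trans ?_
    have hif : (if h 0 = (j : ℕ) then 1 else 0) = if 0 = (j : ℕ) then 1 else 0 := by rw [hh₀]
    rw [← hh₁, ← hh₂, ← hh₃, ← hh₄, ← hh₅, ← hh₆, ← hif]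
    rfl

/-! ### The classification -/

/-- The comparison of coefficients in `∑ δ_j t^j = 1 + ∑ t^{i_k}`. -/
theorem IsExponentSequence.apply_eq {d : ℕ} {δ : Fin (d + 1) → ℕ} {i : ℕ → ℕ}
    (hi : IsExponentSequence δ i) (j : Fin (d + 1)) :
    δ j = (if 0 = (j : ℕ) then 1 else 0) +
      ((Finset.Icc 1 6).filter fun k => i k = (j : ℕ)).card := by
  have h := congrArg (fun q : Polynomial ℤ => q.coeff j) hi.2.2.2.2.2.2
  simp only [Polynomial.finsetSum_coeff, Polynomial.coeff_C_mul, Polynomial.coeff_X_pow,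
    Polynomial.coeff_add, Polynomial.coeff_one, mul_ite, mul_one, mul_zero, Fin.val_inj,
    Finset.sum_ite_eq, Finset.mem_univ, if_true] at h
  rw [Finset.card_filter]
  simp only [eq_comm (b := (j : ℕ))]
  exact_mod_cast h

theorem IsExponentSequence.monotoneOn {d : ℕ} {δ : Fin (d + 1) → ℕ} {i : ℕ → ℕ}
    (hi : IsExponentSequence δ i) : MonotoneOn i (Set.Icc 1 6) := by
  obtain ⟨-, h₁, h₂, h₃, h₄, h₅, -⟩ := hi
  rintro k ⟨hk1, hk6⟩ l ⟨hl1, hl6⟩ hkl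
  interval_cases k <;> interval_cases l <;> omega

/-- The weight box of a simplex of normalized volume `7` is cyclic of order `7`, and the exponents
are the sorted heights of its nonzero elements. -/
theorem exponentConditions_of_simplex {d : ℕ} {δ : Fin (d + 1) → ℕ} (hδ : ∑ j, δ j = 7)
    {i : ℕ → ℕ} (hi : IsExponentSequence δ i) (s : Affine.Simplex ℝ (Fin d → ℝ) d)
    (hs : IsIntegralSimplex s) (hsδ : ∀ j, deltaVector d (simplexBody s) j = (δ j : ℤ)) :
    ExponentConditions d i := by
  have hcard : (weightBox s.points).ncard = 7 := by
    have := sum_deltaVector_simplexBody s hs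
    simp only [hsδ] at this
    rw [← hδ]
    exact_mod_cast this.symm
  obtain ⟨a, ha, hsum, hbox⟩ := exists_weightBox_eq_range_residueWeights hs hcard
  have hpos : ∀ k ∈ Set.Icc 1 (7 - 1), 1 ≤ i k := fun k hk => (hi.1 k (Finset.mem_Icc.2 hk)).1
  have heq : ∀ u, (Finset.univ.filter fun m => residueHeight a m = u).card =
      (if 0 = u then 1 else 0) + ((Finset.Icc 1 6).filter fun k => i k = u).card := by
    intro u
    rcases lt_or_ge u (d + 1) with hu | hu
    · have h1 := hsδ ⟨u, hu⟩
      rw [deltaVector_simplexBody s hs, Nat.cast_inj, ncard_weightBox_sum_eq ha hsum hbox,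
        hi.apply_eq] at h1
      exact h1
    · rw [Finset.filter_false_of_mem, Finset.filter_false_of_mem, if_neg (by omega)]
      · rfl
      · intro k hk
        have := (hi.1 k hk).2
        omega
      · intro m _
        have := residueHeight_lt_card hsum m
        rw [Fintype.card_fin] at this
        omega
  have hcount : ∀ t, (Finset.univ.filter fun m => residueHeight a m ≤ t).card =
      1 + ((Finset.Icc 1 (7 - 1)).filter fun k => i k ≤ t).card := by
    intro t
    rw [Finset.card_eq_sum_card_fiberwise (f := residueHeight a) (t := Finset.range (t + 1))
        (fun m hm => by simpa [Nat.lt_succ_iff] using hm),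
      Finset.card_eq_sum_card_fiberwise (f := i) (t := Finset.range (t + 1))
        (s := (Finset.Icc 1 (7 - 1)).filter fun k => i k ≤ t)
        (fun m hm => by simpa [Nat.lt_succ_iff] using (Finset.mem_filter.1 hm).2)]
    have hone : ∑ u ∈ Finset.range (t + 1), (if 0 = u then 1 else 0) = 1 := by simp
    refine Eq.trans ?_ (congrArg₂ (· + ·) hone rfl)
    rw [← Finset.sum_add_distrib]
    refine Finset.sum_congr rfl fun u hu => ?_
    rw [Finset.mem_range] at hu
    rw [Finset.filter_filter, Finset.filter_filter]
    have e1 : ∀ x : ℕ, (x ≤ t ∧ x = u) ↔ x = u := fun x => by omega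
    simp only [e1]
    exact heq u
  have hsymm := fun k hk => sorted_add_sorted_sub hi.monotoneOn hcount (residueHeight_zero a) hpos
    (fun m hm => residueHeight_add_neg hsum hm) (k := k) hk
  have h1 := hsymm 1 (by simp)
  have h2 := hsymm 2 (by simp)
  have h3 := hsymm 3 (by simp)
  have hle : (Finset.univ.filter fun k => a k ≠ 0).card ≤ d + 1 :=
    (Finset.card_le_univ _).trans_eq (Fintype.card_fin _)
  exact ⟨⟨h1.trans h2.symm, h2.trans h3.symm, h3.trans_le hle⟩, fun k l hk hkl hsix =>
    sorted_add_le hi.monotoneOn hcount (residueHeight_add_le hsum) hk (hk.trans hkl) hsix⟩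

/-- All requirements on the listed parameters, including the six heights, are linear consequences
of the exponent conditions and of the equalities that define the case. -/
theorem explicitRealizations_of_exponentConditions {d : ℕ} {δ : Fin (d + 1) → ℕ} {i : ℕ → ℕ}
    (hi : IsExponentSequence δ i) (hc : ExponentConditions d i) :
    ExplicitRealizations δ (i 1) (i 2) (i 3) (i 4) (i 5) (i 6) := by
  have hδ := hi.apply_eq
  simp only [Finset.card_filter, Finset.sum_Icc_succ_top, Nat.reduceLeDiff, Nat.reduceAdd,
    Finset.Icc_self, Finset.sum_singleton, ← add_assoc] at hδ
  obtain ⟨hbd, h12, h23, h34, h45, h56, -⟩ := hi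
  have hb := hbd 1 (by simp)
  have hd : 1 ≤ d := hb.1.trans hb.2
  obtain ⟨⟨hs1, hs2, hs3⟩, hadd⟩ := hc
  have a11 := hadd 1 1 (by simp) (by simp) (by simp)
  have a12 := hadd 1 2 (by simp) (by simp) (by simp)
  have a13 := hadd 1 3 (by simp) (by simp) (by simp)
  have a14 := hadd 1 4 (by simp) (by simp) (by simp)
  have a15 := hadd 1 5 (by simp) (by simp) (by simp)
  have a22 := hadd 2 2 (by simp) (by simp) (by simp)
  have a23 := hadd 2 3 (by simp) (by simp) (by simp)
  have a24 := hadd 2 4 (by simp) (by simp) (by simp)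
  have a33 := hadd 3 3 (by simp) (by simp) (by simp)
  simp only [Nat.reduceAdd] at a11 a12 a13 a14 a15 a22 a23 a24 a33
  clear hadd hbd
  generalize i 1 = x₁ at *
  generalize i 2 = x₂ at *
  generalize i 3 = x₃ at *
  generalize i 4 = x₄ at *
  generalize i 5 = x₅ at *
  generalize i 6 = x₆ at *
  -- In all cases but one the multiplier `m` has the `m`-th smallest height.
  have realize := fun {c₁ c₂ c₃ c₄ c₅ c₆ : ℤ} =>
    realizedByP7_of_heights hd hδ (c₁ := c₁) (c₂ := c₂) (c₃ := c₃) (c₄ := c₄) (c₅ := c₅) (c₆ := c₆)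
  simp only [Set.mem_Ico] at realize
  unfold ExplicitRealizations
  rcases h12.eq_or_lt with e12 | l12 <;> rcases h23.eq_or_lt with e23 | l23 <;>
    rcases h34.eq_or_lt with e34 | l34
  · left
    refine ⟨by omega, by omega, by omega, by omega, by omega, ?_⟩
    apply realize <;> omega
  · right; left
    refine ⟨by omega, by omega, by omega, by omega, by omega, ?_⟩
    apply realize <;> omega
  · right; right; right; left
    refine ⟨by omega, by omega, by omega, by omega, by omega, ?_⟩
    apply realize <;> omega
  · right; right; right; right; right; left
    refine ⟨by omega, by omega, by omega, by omega, by omega, ?_⟩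
    apply realize <;> omega
  · right; right; left
    refine ⟨by omega, by omega, by omega, by omega, by omega, ?_⟩
    -- Here the multipliers `1, 2` and `5, 6` have their heights interchanged.
    have hδ' := fun j => (hδ j).trans (by ring :
      _ = (if 0 = (j : ℕ) then 1 else 0) +
      (if x₂ = (j : ℕ) then 1 else 0) + (if x₁ = (j : ℕ) then 1 else 0) +
      (if x₃ = (j : ℕ) then 1 else 0) + (if x₄ = (j : ℕ) then 1 else 0) +
      (if x₆ = (j : ℕ) then 1 else 0) + (if x₅ = (j : ℕ) then 1 else 0))
    apply realizedByP7_of_heights hd hδ' <;> first | omega | exact ⟨by omega, by omega⟩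
  · right; right; right; right; left
    refine ⟨by omega, by omega, by omega, by omega, by omega, ?_⟩
    apply realize <;> omega
  · right; right; right; right; right; right; left
    refine ⟨by omega, by omega, by omega, by omega, by omega, ?_⟩
    apply realize <;> omega
  · right; right; right; right; right; right; right
    refine ⟨by omega, by omega, by omega, by omega, by omega, fun h => ?_, fun h => ?_⟩ <;>
      apply realize <;> omega

/-- Classification of the δ-vectors of integral `d`-simplices in `ℝ^d` with normalized volume `7`,
together with the explicit simplices that realize them. -/
theorem theorem0p3 (d : ℕ) (δ : Fin (d + 1) → ℕ) (hδ₀ : δ 0 = 1) (hδ : ∑ j, δ j = 7)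
    (i : ℕ → ℕ) (hi : IsExponentSequence δ i) :
    ((∃ s : Affine.Simplex ℝ (Fin d → ℝ) d,
        IsIntegralSimplex s ∧ ∀ j, deltaVector d (simplexBody s) j = (δ j : ℤ)) ↔
      ExponentConditions d i) ∧
    (ExponentConditions d i →
      ExplicitRealizations δ (i 1) (i 2) (i 3) (i 4) (i 5) (i 6)) := by
  refine ⟨⟨fun ⟨s, hs, hsδ⟩ => exponentConditions_of_simplex hδ hi s hs hsδ, fun hc => ?_⟩,
    explicitRealizations_of_exponentConditions hi⟩
  have hreal : ∀ {c : Fin 6 → ℤ}, RealizedByP7 δ c → ∃ s : Affine.Simplex ℝ (Fin d → ℝ) d,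
      IsIntegralSimplex s ∧ ∀ j, deltaVector d (simplexBody s) j = (δ j : ℤ) :=
    fun ⟨_, _, s, _, hs, hsδ⟩ => ⟨s, hs, hsδ⟩
  rcases explicitRealizations_of_exponentConditions hi hc with
    ⟨-, -, -, -, -, h⟩ | ⟨-, -, -, -, -, h⟩ | ⟨-, -, -, -, -, h⟩ | ⟨-, -, -, -, -, h⟩ |
    ⟨-, -, -, -, -, h⟩ | ⟨-, -, -, -, -, h⟩ | ⟨-, -, -, -, -, h⟩ | ⟨-, -, -, -, -, h, h'⟩
  iterate 7 exact hreal h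
  rcases le_total (2 * (i 2 : ℤ)) (i 1 + i 3) with hle | hle
  · exact hreal (h hle)
  · exact hreal (h' hle)
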